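/- Let $r_n>0$ and $d_n\ge 0$ for $n\ge 1$, $a_1=0$, $a_n>0$ for $n\ge 2$, and put $\theta_n=r_n+a_n+d_n$. Let $X$ be the Banach space of real sequences $\mathbf f=(f_n)_{n\ge1}$ with $\|\mathbf f\|=\sum_{n\ge1}n|f_n|<\infty$, ordered coordinatewise. For an arbitrary real sequence $\mathbf f$ put $[\mathbb A_0\mathbf f]_n=-\theta_nf_n$ and $[\mathbb A_1\mathbf f]_n=r_{n+1}f_{n+1}$. Let $A_0$ and $A_1$ be the restrictions of $\mathbb A_0$ and $\mathbb A_1$ to $D(A_0)=\{\mathbf f\in X:(\theta_nf_n)_n\in X\}$ and $D(A_1)=\{\mathbf f\in X:(r_nf_n)_n\in X\}\supset D(A_0)$. A $C_0$-semigroup on $X$ is called substochastic if it consists of positive contractions. Let $K=\overline{A_0+A_1}$ be the closure of $(A_0+A_1,D(A_0))$ in $X$, and let $K_{\max}=\mathbb A_0+\mathbb A_1$ on $D(K_{\max})=\{\mathbf f\in X:\mathbb A_0\mathbf f+\mathbb A_1\mathbf f\in X\}$. Then $A_0+A_1$ is closable, and $K$ generates a substochastic $C_0$-semigroup on $X$,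 which is the smallest among all substochastic $C_0$-semigroups whose generators extend $A_0+A_1$. Moreover, for every $\lambda>0$: 1. $D(K)=D(K_{\max})$ if and only if there is no nonzero $\mathbf f\in X$ satisfying $\mathbb A_0\mathbf f+\mathbb A_1\mathbf f=\lambda\mathbf f$; 2. the space of all real sequences $\mathbf f$ satisfying $\mathbb A_0\mathbf f+\mathbb A_1\mathbf f=\lambda\mathbf f$ is at most one-dimensional, and so is the space of those solutions that belong to $X$. -/

import Mathlib

open Filter Topology
open scoped NNReal

/-! ### The sequence space -/

/-- The real sequences `f = (f n)`, `n ≥ 1`, with `∑ n |f n| < ∞`. -/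
def finiteMass : Submodule ℝ (ℕ+ → ℝ) where
  carrier := {f | Summable fun n : ℕ+ => (n : ℝ) * |f n|}
  zero_mem' := by simp
  add_mem' := by
    intro f g hf hg
    refine Summable.of_nonneg_of_le (fun n => by positivity) (fun n => ?_) (hf.add hg)
    rw [← mul_add]
    exact mul_le_mul_of_nonneg_left (abs_add_le _ _) (by positivity)
  smul_mem' := by
    intro c f hf
    refine (hf.mul_left |c|).congr fun n => ?_
    simp only [Pi.smul_apply, smul_eq_mul, abs_mul]
    ring

/-- The space `X` of real sequences of finite mass. It is a type of its own, so that its topology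
is that of the norm below and not that of pointwise convergence. -/
def MassSpace : Type := ↥finiteMass

namespace MassSpace

instance : AddCommGroup MassSpace := inferInstanceAs (AddCommGroup ↥finiteMass)

instance : Module ℝ MassSpace := inferInstanceAs (Module ℝ ↥finiteMass)

/-- The sequence underlying an element of `X`, as a linear map. -/
def seq : MassSpace →ₗ[ℝ] (ℕ+ → ℝ) := finiteMass.subtype

/-- A sequence of finite mass as an element of `X`. -/
def mk (f : ℕ+ → ℝ) (hf : f ∈ finiteMass) : MassSpace := ⟨f, hf⟩

theorem seq_mem (f : MassSpace) : seq f ∈ finiteMass := f.2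

@[simp] theorem seq_mk (f : ℕ+ → ℝ) (hf : f ∈ finiteMass) : seq (mk f hf) = f := rfl

theorem seq_injective : Function.Injective seq := Subtype.val_injective

/-- The norm `‖f‖ = ∑ n |f n|`, the total mass. -/
noncomputable instance : Norm MassSpace := ⟨fun f => ∑' n : ℕ+, (n : ℝ) * |seq f n|⟩

theorem norm_def (f : MassSpace) : ‖f‖ = ∑' n : ℕ+, (n : ℝ) * |seq f n| := rfl

theorem normedSpaceCore : NormedSpace.Core ℝ MassSpace where
  norm_nonneg f := tsum_nonneg fun n => by positivity
  norm_smul c f := by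
    rw [norm_def, norm_def, ← tsum_mul_left]
    refine tsum_congr fun n => ?_
    simp only [map_smul, Pi.smul_apply, smul_eq_mul, abs_mul, Real.norm_eq_abs]
    ring
  norm_triangle f g := by
    have hf : Summable fun n : ℕ+ => (n : ℝ) * |seq f n| := seq_mem f
    have hg : Summable fun n : ℕ+ => (n : ℝ) * |seq g n| := seq_mem g
    have hfg : Summable fun n : ℕ+ => (n : ℝ) * |seq (f + g) n| := seq_mem (f + g)
    rw [norm_def, norm_def, norm_def, ← hf.tsum_add hg]
    refine hfg.tsum_le_tsum (fun n => ?_) (hf.add hg)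
    rw [← mul_add, map_add]
    exact mul_le_mul_of_nonneg_left (abs_add_le _ _) (by positivity)
  norm_eq_zero_iff f := by
    constructor
    · intro h
      have hf : HasSum (fun n : ℕ+ => (n : ℝ) * |seq f n|) 0 := by
        rw [← h, norm_def]
        exact Summable.hasSum (seq_mem f)
      rw [hasSum_zero_iff_of_nonneg fun n => by positivity] at hf
      apply seq_injective
      funext n
      have hn := congrFun hf n
      simpa using hn
    · rintro rfl
      simp [norm_def]

noncomputable instance : NormedAddCommGroup MassSpace :=
  NormedAddCommGroup.ofCore normedSpaceCore

noncomputable instance : NormedSpace ℝ MassSpace := NormedSpace.ofCore normedSpaceCore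

/-- The positive cone of `X`: sequences all of whose terms are nonnegative. -/
def IsNonneg (f : MassSpace) : Prop := ∀ n, 0 ≤ seq f n

end MassSpace

/-! ### The decay operators -/

/-- The coefficient `θ n = r n + a n + d n`. -/
def theta (r a d : ℕ+ → ℝ) (n : ℕ+) : ℝ := r n + a n + d n

/-- The formal diagonal expression `(𝔸₀ f) n = - θ n * f n`, on all real sequences. -/
def formalDiag (r a d : ℕ+ → ℝ) : (ℕ+ → ℝ) →ₗ[ℝ] (ℕ+ → ℝ) where
  toFun f n := -(theta r a d n * f n)
  map_add' f g := by funext n; simp only [Pi.add_apply]; ring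
  map_smul' c f := by
    funext n; simp only [Pi.smul_apply, smul_eq_mul, RingHom.id_apply]; ring

/-- The formal off-diagonal expression `(𝔸₁ f) n = r (n + 1) * f (n + 1)`, on all real
sequences. -/
def formalShift (r : ℕ+ → ℝ) : (ℕ+ → ℝ) →ₗ[ℝ] (ℕ+ → ℝ) where
  toFun f n := r (n + 1) * f (n + 1)
  map_add' f g := by funext n; simp only [Pi.add_apply]; ring
  map_smul' c f := by
    funext n; simp only [Pi.smul_apply, smul_eq_mul, RingHom.id_apply]; ring

/-- The restriction of a formal linear expression `T` to a domain `D ⊆ X` that it maps to `X`, as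
an unbounded operator in `X`. -/
def realization (T : (ℕ+ → ℝ) →ₗ[ℝ] (ℕ+ → ℝ)) (D : Submodule ℝ MassSpace)
    (hD : ∀ f ∈ D, T (MassSpace.seq f) ∈ finiteMass) : MassSpace →ₗ.[ℝ] MassSpace where
  domain := D
  toFun :=
    { toFun := fun f => MassSpace.mk (T (MassSpace.seq f)) (hD f f.2)
      map_add' := fun f g => MassSpace.seq_injective (by simp)
      map_smul' := fun c f => MassSpace.seq_injective (by simp) }

/-- The subspace `{f ∈ X : T f ∈ X}` of `X`, for a formal linear expression `T`. -/
def maximalDomain (T : (ℕ+ → ℝ) →ₗ[ℝ] (ℕ+ → ℝ)) : Submodule ℝ MassSpace :=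
  finiteMass.comap (T ∘ₗ MassSpace.seq)

/-- Multiplication of sequences by a fixed sequence `w`. -/
def formalMul (w : ℕ+ → ℝ) : (ℕ+ → ℝ) →ₗ[ℝ] (ℕ+ → ℝ) := LinearMap.mulLeft ℝ w

/-- The operator `A₀ f = - θ f` with `D(A₀) = {f ∈ X : θ f ∈ X}`. -/
def opDiag (r a d : ℕ+ → ℝ) : MassSpace →ₗ.[ℝ] MassSpace :=
  realization (formalDiag r a d) (maximalDomain (formalMul (theta r a d))) fun f hf => by
    have h : formalDiag r a d (MassSpace.seq f) =
        -formalMul (theta r a d) (MassSpace.seq f) := rfl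
    rw [h]
    exact finiteMass.neg_mem hf

theorem formalShift_mem (r f : ℕ+ → ℝ) (hf : formalMul r f ∈ finiteMass) :
    formalShift r f ∈ finiteMass := by
  have hs : Summable fun n : ℕ+ => (n : ℝ) * |r n * f n| := hf
  have hinj : Function.Injective fun n : ℕ+ => n + 1 := fun m n h => add_right_cancel h
  refine Summable.of_nonneg_of_le (fun n => by positivity) (fun n => ?_) (hs.comp_injective hinj)
  refine mul_le_mul_of_nonneg_right ?_ (abs_nonneg _)
  simp

/-- The operator `(A₁ f) n = r (n + 1) * f (n + 1)` with `D(A₁) = {f ∈ X : r f ∈ X}`. -/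
def opShift (r : ℕ+ → ℝ) : MassSpace →ₗ.[ℝ] MassSpace :=
  realization (formalShift r) (maximalDomain (formalMul r)) fun f hf =>
    formalShift_mem r (MassSpace.seq f) hf

/-- The operator `A₀ + A₁` on `D(A₀) ∩ D(A₁)`, which is `D(A₀)` because `0 ≤ r ≤ θ`. -/
noncomputable def opDecay (r a d : ℕ+ → ℝ) : MassSpace →ₗ.[ℝ] MassSpace :=
  opDiag r a d + opShift r

/-- The operator `K`, the closure of `A₀ + A₁` in `X`. -/
noncomputable def opK (r a d : ℕ+ → ℝ) : MassSpace →ₗ.[ℝ] MassSpace :=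
  (opDecay r a d).closure

/-- The maximal operator `K_max f = 𝔸₀ f + 𝔸₁ f` with
`D(K_max) = {f ∈ X : 𝔸₀ f + 𝔸₁ f ∈ X}`. -/
def opKmax (r a d : ℕ+ → ℝ) : MassSpace →ₗ.[ℝ] MassSpace :=
  realization (formalDiag r a d + formalShift r)
    (maximalDomain (formalDiag r a d + formalShift r)) fun _ hf => hf

/-- The space of all real sequences `f` with `𝔸₀ f + 𝔸₁ f = l f`. -/
def formalSolutions (r a d : ℕ+ → ℝ) (l : ℝ) : Submodule ℝ (ℕ+ → ℝ) :=
  LinearMap.eqLocus (formalDiag r a d + formalShift r) (l • LinearMap.id)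

/-- The space of all `f ∈ X` with `𝔸₀ f + 𝔸₁ f = l f`. -/
def solutionsInX (r a d : ℕ+ → ℝ) (l : ℝ) : Submodule ℝ MassSpace :=
  (formalSolutions r a d l).comap MassSpace.seq

/-! ### Substochastic semigroups -/

/-- A strongly continuous semigroup of bounded linear operators on `X`. -/
structure IsC0Semigroup (S : ℝ≥0 → MassSpace →L[ℝ] MassSpace) : Prop where
  map_zero : S 0 = ContinuousLinearMap.id ℝ MassSpace
  map_add : ∀ s t, S (s + t) = (S s).comp (S t)
  tendsto_zero : ∀ f, Tendsto (fun t => S t f) (𝓝 0) (𝓝 f)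

/-- A strongly continuous semigroup of positive contractions. -/
structure IsSubstochastic (S : ℝ≥0 → MassSpace →L[ℝ] MassSpace) : Prop extends
    IsC0Semigroup S where
  nonneg : ∀ t f, f.IsNonneg → (S t f).IsNonneg
  norm_le_one : ∀ t, ‖S t‖ ≤ 1

/-- `G` is the infinitesimal generator of `S`: a pair `(f, g)` lies on the graph of `G` exactly
when `(S t f - f) / t → g` as `t → 0+`. -/
def IsGenerator (S : ℝ≥0 → MassSpace →L[ℝ] MassSpace) (G : MassSpace →ₗ.[ℝ] MassSpace) : Prop :=
  ∀ f g : MassSpace, (f, g) ∈ G.graph ↔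
    Tendsto (fun t : ℝ≥0 => (t : ℝ)⁻¹ • (S t f - f)) (𝓝[>] 0) (𝓝 g)

/-- `G` is an extension of `L` that generates a substochastic semigroup, and this semigroup is
the smallest among all substochastic semigroups whose generators extend `L`. -/
def GeneratesSmallestSubstochastic (L G : MassSpace →ₗ.[ℝ] MassSpace) : Prop :=
  L ≤ G ∧ ∃ S, IsSubstochastic S ∧ IsGenerator S G ∧
    ∀ (T : ℝ≥0 → MassSpace →L[ℝ] MassSpace) (G' : MassSpace →ₗ.[ℝ] MassSpace),
      IsSubstochastic T → IsGenerator T G' → L ≤ G' →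
        ∀ (t : ℝ≥0) (f : MassSpace), f.IsNonneg → (T t f - S t f).IsNonneg

/-! The system is triangular: writing `e n` for the `n`-th unit sequence, the operator sends `e n`
to `-θ n e n + r n e (n - 1)`, so the trajectory of each `e n` is found by finitely many
applications of variation of constants. It is nonnegative, and its norm stays at most `n = ‖e n‖`,
because `0 ≤ r n ≤ θ n`. As `X` is a weighted `ℓ¹` space, any family `v n` with `‖v n‖ ≤ C n`
extends to a bounded operator of norm at most `C`. The trajectories therefore define positive
contractions `S t` (`DecayRates.semigroup`), and uniqueness for the triangular system gives the
semigroup law. The same uniqueness shows that a substochastic semigroup whose generator extends `A₀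
+ A₁` equals `S` (`eq_semigroup`), so minimality is immediate.

The generator is identified in the manner of Lumer and Phillips. Let `C` be the closure of the
operator on finitely supported sequences. The generator extends `C` and is dissipative; `l - C` has
closed range by dissipativity and dense range by a recursion over the `e n`, hence is onto
(`exists_resolvent`), which leaves no room for a larger generator (`mem_closure_iff_tendsto`).
Truncation shows that `C = K` (`opK_graph_eq`).

Closability holds because `A₀ + A₁` lies in the closed operator `K_max`. Since `l - K` is bijective
and `K ⊆ K_max`, the two agree exactly when `l - K_max` is injective. A formal eigensequence obeys a
one-step recursion, so its first term determines it. -/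

namespace MassSpace

/-! ### Completeness, coordinates and unit vectors -/

theorem seq_ext {f g : MassSpace} (h : ∀ n, seq f n = seq g n) : f = g :=
  seq_injective (funext h)

/-- The isometry `f ↦ (n f n)` of `X` onto `ℓ¹`. -/
noncomputable def toLp : MassSpace ≃ᵢ lp (fun _ : ℕ+ => ℝ) 1 := by
  refine IsometryEquiv.mk
    { toFun := fun f => ⟨fun n => (n : ℝ) * seq f n, memℓp_gen ?_⟩
      invFun := fun g => mk (fun n => (n : ℝ)⁻¹ * g n) ?_
      left_inv := fun f => seq_ext fun n => ?_
      right_inv := fun g => lp.ext (funext fun n => ?_) } ?_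
  · simpa [finiteMass, abs_mul] using seq_mem f
  · have h := (lp.memℓp g).summable (by simp)
    simpa [finiteMass, abs_mul] using h
  · simp
  · simp
  · refine Isometry.of_dist_eq fun f g => ?_
    rw [dist_eq_norm, dist_eq_norm, lp.norm_eq_tsum_rpow (by simp), norm_def]
    simp only [ENNReal.toReal_one, Real.rpow_one, div_one, map_sub, Pi.sub_apply]
    refine tsum_congr fun n => ?_
    change |(n : ℝ) * seq f n - n * seq g n| = _
    rw [← mul_sub, abs_mul, Nat.abs_cast]

instance : CompleteSpace MassSpace := toLp.completeSpace

theorem mul_abs_seq_le (f : MassSpace) (n : ℕ+) : (n : ℝ) * |seq f n| ≤ ‖f‖ :=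
  Summable.le_tsum (seq_mem f) n fun k _ => by positivity

theorem abs_seq_le (f : MassSpace) (n : ℕ+) : |seq f n| ≤ ‖f‖ := by
  refine le_trans ?_ (mul_abs_seq_le f n)
  have : (1 : ℝ) ≤ n := by exact_mod_cast one_le
  exact le_mul_of_one_le_left (abs_nonneg _) this

/-- The `n`-th coordinate as a bounded functional. -/
noncomputable def coord (n : ℕ+) : MassSpace →L[ℝ] ℝ :=
  LinearMap.mkContinuous (LinearMap.proj n ∘ₗ seq) 1 fun f => by
    simpa using abs_seq_le f n

@[simp] theorem coord_apply (n : ℕ+) (f : MassSpace) : coord n f = seq f n := rfl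

theorem seq_tsum {ι : Type*} {v : ι → MassSpace} (hv : Summable v) (k : ℕ+) :
    seq (∑' i, v i) k = ∑' i, seq (v i) k :=
  (coord k).map_tsum hv

theorem single_mem (n : ℕ+) : (Pi.single n 1 : ℕ+ → ℝ) ∈ finiteMass :=
  summable_of_ne_finset_zero (s := {n}) fun k hk => by
    simp [Pi.single_eq_of_ne (Finset.notMem_singleton.mp hk)]

/-- The `n`-th unit sequence. -/
noncomputable def unit (n : ℕ+) : MassSpace := mk (Pi.single n 1) (single_mem n)

theorem seq_unit (n k : ℕ+) : seq (unit n) k = if k = n then 1 else 0 := by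
  simp [unit, Pi.single_apply]

theorem norm_unit (n : ℕ+) : ‖unit n‖ = n := by
  rw [norm_def, tsum_eq_single n fun k hk => by simp [seq_unit, hk]]
  simp [seq_unit]

theorem isNonneg_unit (n : ℕ+) : (unit n).IsNonneg := fun k => by
  rw [seq_unit]; split_ifs <;> norm_num

/-- The weight in the norm of `X` matches the growth allowed for `v`, so the series converges
absolutely. -/
theorem summable_smul {v : ℕ+ → MassSpace} {C : ℝ} (hv : ∀ n, ‖v n‖ ≤ C * n) (f : MassSpace) :
    Summable fun n => seq f n • v n := by
  have hs : Summable fun n : ℕ+ => (n : ℝ) * |seq f n| := seq_mem f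
  refine Summable.of_norm_bounded (hs.mul_left C) fun n => ?_
  rw [norm_smul, Real.norm_eq_abs]
  nlinarith [mul_le_mul_of_nonneg_right (hv n) (abs_nonneg (seq f n))]

theorem hasSum_unit (f : MassSpace) : HasSum (fun n => seq f n • unit n) f := by
  have hs := summable_smul (v := unit) (C := 1) (fun n => by simp [norm_unit]) f
  convert hs.hasSum
  refine seq_ext fun k => ?_
  rw [seq_tsum hs, tsum_eq_single k fun n hn => by simp [seq_unit, hn.symm]]
  simp [seq_unit]

theorem span_unit_dense {W : Submodule ℝ MassSpace} (hW : ∀ n, unit n ∈ W) :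
    Dense (W : Set MassSpace) := fun f =>
  mem_closure_of_tendsto (hasSum_unit f) <| .of_forall fun _ =>
    W.sum_mem fun n _ => W.smul_mem _ (hW n)

/-- The bounded operator with prescribed values on the unit sequences. -/
noncomputable def ofUnits (v : ℕ+ → MassSpace) (C : ℝ) (hv : ∀ n, ‖v n‖ ≤ C * n) :
    MassSpace →L[ℝ] MassSpace :=
  LinearMap.mkContinuous
    { toFun := fun f => ∑' n, seq f n • v n
      map_add' := fun f g => by
        rw [← (summable_smul hv f).tsum_add (summable_smul hv g)]
        simp [add_smul]
      map_smul' := fun c f => by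
        rw [RingHom.id_apply, ← (summable_smul hv f).tsum_const_smul c]
        simp [mul_smul] } C fun f => by
    have hs : Summable fun n : ℕ+ => (n : ℝ) * |seq f n| := seq_mem f
    refine tsum_of_norm_bounded (hs.hasSum.mul_left C) fun n => ?_
    rw [norm_smul, Real.norm_eq_abs]
    nlinarith [mul_le_mul_of_nonneg_right (hv n) (abs_nonneg (seq f n))]

theorem ofUnits_apply {v : ℕ+ → MassSpace} {C : ℝ} (hv : ∀ n, ‖v n‖ ≤ C * n) (f : MassSpace) :
    ofUnits v C hv f = ∑' n, seq f n • v n := rfl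

theorem ofUnits_unit {v : ℕ+ → MassSpace} {C : ℝ} (hv : ∀ n, ‖v n‖ ≤ C * n) (n : ℕ+) :
    ofUnits v C hv (unit n) = v n := by
  rw [ofUnits_apply, tsum_eq_single n fun k hk => by simp [seq_unit, hk]]
  simp [seq_unit]

theorem norm_ofUnits_le {v : ℕ+ → MassSpace} {C : ℝ} (hC : 0 ≤ C) (hv : ∀ n, ‖v n‖ ≤ C * n) :
    ‖ofUnits v C hv‖ ≤ C :=
  LinearMap.mkContinuous_norm_le _ hC _

theorem isNonneg_ofUnits {v : ℕ+ → MassSpace} {C : ℝ} (hv : ∀ n, ‖v n‖ ≤ C * n)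
    (hpos : ∀ n, (v n).IsNonneg) {f : MassSpace} (hf : f.IsNonneg) :
    (ofUnits v C hv f).IsNonneg := fun k => by
  rw [ofUnits_apply, seq_tsum (summable_smul hv f)]
  exact tsum_nonneg fun n => by simpa using mul_nonneg (hf n) (hpos n k)

theorem clm_ext_unit {S T : MassSpace →L[ℝ] MassSpace} (h : ∀ n, S (unit n) = T (unit n)) :
    S = T := by
  ext1 f
  have hS := S.hasSum (hasSum_unit f)
  have hT := T.hasSum (hasSum_unit f)
  simp only [map_smul, h] at hS hT
  exact hS.unique hT

end MassSpace

/-! ### The equations for the unit sequences -/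

/-- The sequence `v` shifted to the right, `(0, v 1, v 2, …)`. -/
def prev {M : Type*} [Zero M] (v : ℕ+ → M) (n : ℕ+) : M := PNat.recOn n 0 fun k _ => v k

@[simp] theorem prev_one {M : Type*} [Zero M] (v : ℕ+ → M) : prev v 1 = 0 := rfl

@[simp] theorem prev_succ {M : Type*} [Zero M] (v : ℕ+ → M) (n : ℕ+) : prev v (n + 1) = v n :=
  PNat.recOn_succ ..

theorem map_prev {M N F : Type*} [Zero M] [Zero N] [FunLike F M N] [ZeroHomClass F M N] (φ : F)
    (v : ℕ+ → M) (n : ℕ+) : φ (prev v n) = prev (fun k => φ (v k)) n := by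
  induction n using PNat.recOn with
  | one => simp
  | succ n _ => simp

open MassSpace

theorem formalShift_single (r : ℕ+ → ℝ) (n : ℕ+) :
    formalShift r (Pi.single n 1) = seq (r n • prev unit n) := by
  funext k
  change r (k + 1) * (Pi.single n 1 : ℕ+ → ℝ) (k + 1) = _
  induction n using PNat.recOn with
  | one => simp [Pi.single_eq_of_ne (PNat.lt_add_left 1 k).ne']
  | succ n _ =>
    by_cases h : k = n
    · subst h; simp [seq_unit]
    · simp [seq_unit, h]

/-- The image `- θ n e n + r n e (n - 1)` of the `n`-th unit sequence `e n`. -/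
noncomputable def unitImage (r a d : ℕ+ → ℝ) (n : ℕ+) : MassSpace :=
  -(theta r a d n • unit n) + r n • prev unit n

theorem seq_unitImage (r a d : ℕ+ → ℝ) (n : ℕ+) :
    seq (unitImage r a d n) = (formalDiag r a d + formalShift r) (seq (unit n)) := by
  have h : seq (unit n) = Pi.single n 1 := rfl
  rw [LinearMap.add_apply, h, formalShift_single, ← h, unitImage, map_add]
  congr 1
  funext k
  by_cases hk : k = n
  · simp [formalDiag, hk]
  · simp [formalDiag, seq_unit, hk]

/-- A family of curves solving `u n' = - θ n u n + r n u (n - 1)` for all times `t ≥ 0`. -/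
structure IsDecayFlow (r a d : ℕ+ → ℝ) (u : ℕ+ → ℝ → MassSpace) : Prop where
  continuous : ∀ n, Continuous (u n)
  deriv : ∀ n t, 0 ≤ t → HasDerivWithinAt (u n)
    (-(theta r a d n • u n t) + r n • prev (fun k => u k t) n) (Set.Ici t) t

/-- Once the preceding curves agree, the difference solves `z' = -θ n z`, `z 0 = 0`, and vanishes by
Grönwall. Right derivatives suffice, and these are what orbits of an abstract semigroup provide. -/
theorem IsDecayFlow.unique {r a d : ℕ+ → ℝ} {u w : ℕ+ → ℝ → MassSpace}
    (hu : IsDecayFlow r a d u) (hw : IsDecayFlow r a d w) (h0 : ∀ n, u n 0 = w n 0) (n : ℕ+) :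
    ∀ t, 0 ≤ t → u n t = w n t := by
  have key : ∀ n, (∀ t, 0 ≤ t → prev (fun k => u k t) n = prev (fun k => w k t) n) →
      ∀ t, 0 ≤ t → u n t = w n t := by
    intro n hn t ht
    have hd : ∀ s, 0 ≤ s → HasDerivWithinAt (fun t => u n t - w n t)
        (-(theta r a d n • (u n s - w n s))) (Set.Ici s) s := fun s hs => by
      refine ((hu.deriv n s hs).sub (hw.deriv n s hs)).congr_deriv ?_
      rw [hn s hs, smul_sub]
      abel
    refine sub_eq_zero.mp <| eq_zero_of_abs_deriv_le_mul_abs_self_of_eq_zero_right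
      (f := fun t => u n t - w n t) (f' := fun t => -(theta r a d n • (u n t - w n t)))
      (K := |theta r a d n|) (a := 0) (b := t)
      ((hu.continuous n).sub (hw.continuous n)).continuousOn
      (fun s hs => hd s hs.1) (by simp [h0]) (fun s _ => by simp [norm_smul]) t ⟨ht, le_rfl⟩
  induction n using PNat.recOn with
  | one => exact key 1 fun t _ => by simp
  | succ n ih => exact key _ fun t ht => by simpa using ih t ht

theorem IsDecayFlow.map {r a d : ℕ+ → ℝ} {u : ℕ+ → ℝ → MassSpace} (hu : IsDecayFlow r a d u)
    (T : MassSpace →L[ℝ] MassSpace) : IsDecayFlow r a d fun n t => T (u n t) where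
  continuous n := T.continuous.comp (hu.continuous n)
  deriv n t ht := by
    refine (T.hasFDerivAt.comp_hasDerivWithinAt t (hu.deriv n t ht)).congr_deriv ?_
    rw [map_add, map_neg, map_smul, map_smul, map_prev]

theorem IsDecayFlow.shift {r a d : ℕ+ → ℝ} {u : ℕ+ → ℝ → MassSpace} (hu : IsDecayFlow r a d u)
    {s : ℝ} (hs : 0 ≤ s) : IsDecayFlow r a d fun n t => u n (t + s) where
  continuous n := (hu.continuous n).comp (continuous_id.add continuous_const)
  deriv n t ht := by
    have h1 : HasDerivWithinAt (fun t => t + s) 1 (Set.Ici t) t :=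
      (hasDerivWithinAt_id t _).add_const s
    exact ((hu.deriv n (t + s) (by positivity)).scomp t h1
      fun x hx => by simpa using hx).congr_deriv (one_smul _ _)

/-! ### Existence of the flow -/

section Duhamel

variable {E : Type*} [NormedAddCommGroup E] [NormedSpace ℝ E]

/-- The solution of `v' = - c v + g`, `v 0 = x`. -/
noncomputable def duhamel (c : ℝ) (x : E) (g : ℝ → E) (t : ℝ) : E :=
  Real.exp (-(c * t)) • (x + ∫ s in (0 : ℝ)..t, Real.exp (c * s) • g s)

variable {c : ℝ} {x : E} {g : ℝ → E}

@[simp] theorem duhamel_zero : duhamel c x g 0 = x := by simp [duhamel]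

theorem hasDerivAt_duhamel [CompleteSpace E] (hg : Continuous g) (t : ℝ) :
    HasDerivAt (duhamel c x g) (-(c • duhamel c x g t) + g t) t := by
  have hF : Continuous fun s => Real.exp (c * s) • g s := by fun_prop
  have h1 : HasDerivAt (fun t => x + ∫ s in (0 : ℝ)..t, Real.exp (c * s) • g s)
      (Real.exp (c * t) • g t) t :=
    (intervalIntegral.integral_hasDerivAt_right (hF.intervalIntegrable _ _)
      hF.stronglyMeasurable.stronglyMeasurableAtFilter hF.continuousAt).const_add x
  have h2 : HasDerivAt (fun t => Real.exp (-(c * t))) (Real.exp (-(c * t)) * -(c * 1)) t :=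
    ((hasDerivAt_id t).const_mul c).neg.exp
  refine (h2.smul h1).congr_deriv ?_
  have h3 : Real.exp (-(c * t)) * Real.exp (c * t) = 1 := by rw [← Real.exp_add]; simp
  rw [smul_smul, h3, one_smul, duhamel, smul_smul, ← neg_smul, add_comm]
  congr 2
  ring

theorem isNonneg_duhamel {x : MassSpace} {g : ℝ → MassSpace} (hg : Continuous g) (hx : x.IsNonneg)
    (hpos : ∀ t, 0 ≤ t → (g t).IsNonneg) {t : ℝ} (ht : 0 ≤ t) : (duhamel c x g t).IsNonneg := by
  intro k
  have hF : Continuous fun s => Real.exp (c * s) • g s := by fun_prop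
  have h : seq (∫ s in (0 : ℝ)..t, Real.exp (c * s) • g s) k =
      ∫ s in (0 : ℝ)..t, coord k (Real.exp (c * s) • g s) :=
    ((coord k).intervalIntegral_comp_comm (hF.intervalIntegrable _ _)).symm
  simp only [duhamel, map_smul, map_add, Pi.smul_apply, Pi.add_apply, smul_eq_mul, h]
  refine mul_nonneg (Real.exp_nonneg _) (add_nonneg (hx k) ?_)
  refine intervalIntegral.integral_nonneg ht fun s hs => ?_
  exact mul_nonneg (Real.exp_nonneg _) (hpos s hs.1 k)

/-- The ball of radius `M` is invariant: the bound obtained is `exp (-c t) (M + (exp (c t) - 1) M) =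
M`. -/
theorem norm_duhamel_le (hc : 0 < c) {M : ℝ} (hx : ‖x‖ ≤ M)
    (hM : ∀ t, 0 ≤ t → ‖g t‖ ≤ c * M) {t : ℝ} (ht : 0 ≤ t) : ‖duhamel c x g t‖ ≤ M := by
  have hI : ∫ s in (0 : ℝ)..t, Real.exp (c * s) * (c * M) = (Real.exp (c * t) - 1) * M := by
    rw [intervalIntegral.integral_mul_const, intervalIntegral.integral_comp_mul_left _ hc.ne']
    simp only [mul_zero, integral_exp, Real.exp_zero, smul_eq_mul]
    field_simp
  have h1 : ‖∫ s in (0 : ℝ)..t, Real.exp (c * s) • g s‖ ≤ (Real.exp (c * t) - 1) * M := by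
    rw [← hI]
    refine intervalIntegral.norm_integral_le_of_norm_le ht (.of_forall fun s hs => ?_)
      (Continuous.intervalIntegrable (by fun_prop) _ _)
    rw [norm_smul, Real.norm_eq_abs, Real.abs_exp]
    exact mul_le_mul_of_nonneg_left (hM s hs.1.le) (Real.exp_nonneg _)
  rw [duhamel, norm_smul, Real.norm_eq_abs, Real.abs_exp]
  calc Real.exp (-(c * t)) * ‖x + ∫ s in (0 : ℝ)..t, Real.exp (c * s) • g s‖
      ≤ Real.exp (-(c * t)) * (M + (Real.exp (c * t) - 1) * M) :=
        mul_le_mul_of_nonneg_left ((norm_add_le _ _).trans (add_le_add hx h1)) (Real.exp_nonneg _)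
    _ = (Real.exp (-(c * t)) * Real.exp (c * t)) * M := by ring
    _ = M := by rw [← Real.exp_add]; simp

end Duhamel

/-- The trajectory of the `n`-th unit sequence. -/
noncomputable def unitFlow (r a d : ℕ+ → ℝ) (n : ℕ+) : ℝ → MassSpace :=
  PNat.recOn n (duhamel (theta r a d 1) (unit 1) fun _ => 0)
    fun k v => duhamel (theta r a d (k + 1)) (unit (k + 1)) fun t => r (k + 1) • v t

section Flow

variable {r a d : ℕ+ → ℝ}

theorem unitFlow_eq (n : ℕ+) : unitFlow r a d n =
    duhamel (theta r a d n) (unit n) fun t => r n • prev (fun k => unitFlow r a d k t) n := by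
  induction n using PNat.recOn with
  | one => simp only [prev_one, smul_zero]; rfl
  | succ n _ => simp only [prev_succ]; exact PNat.recOn_succ ..

theorem unitFlow_zero (n : ℕ+) : unitFlow r a d n 0 = unit n := by
  rw [unitFlow_eq, duhamel_zero]

theorem continuous_prev_unitFlow (n : ℕ+) :
    Continuous fun t => prev (fun k => unitFlow r a d k t) n := by
  induction n using PNat.recOn with
  | one => simpa using continuous_const
  | succ n ih =>
    simp only [prev_succ]
    have h : Continuous fun t => r n • prev (fun k => unitFlow r a d k t) n := ih.fun_const_smul _
    have hd := fun t => (hasDerivAt_duhamel (c := theta r a d n) (x := unit n) h t).continuousAt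
    rw [← unitFlow_eq] at hd
    exact continuous_iff_continuousAt.mpr hd

theorem hasDerivAt_unitFlow (n : ℕ+) (t : ℝ) : HasDerivAt (unitFlow r a d n)
    (-(theta r a d n • unitFlow r a d n t) + r n • prev (fun k => unitFlow r a d k t) n) t := by
  have hc : Continuous fun t => r n • prev (fun k => unitFlow r a d k t) n :=
    (continuous_prev_unitFlow n).fun_const_smul _
  have h := hasDerivAt_duhamel (c := theta r a d n) (x := unit n) hc t
  rwa [← unitFlow_eq] at h

variable (r a d) in
theorem isDecayFlow_unitFlow : IsDecayFlow r a d (unitFlow r a d) where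
  continuous n := continuous_iff_continuousAt.mpr fun t => (hasDerivAt_unitFlow n t).continuousAt
  deriv n t _ := (hasDerivAt_unitFlow n t).hasDerivWithinAt

theorem isNonneg_unitFlow (hr : ∀ n, 0 ≤ r n) (n : ℕ+) {t : ℝ} (ht : 0 ≤ t) :
    (unitFlow r a d n t).IsNonneg := by
  have key : ∀ n, (∀ t, 0 ≤ t → (prev (fun k => unitFlow r a d k t) n).IsNonneg) →
      ∀ t, 0 ≤ t → (unitFlow r a d n t).IsNonneg := by
    intro n hn t ht
    rw [unitFlow_eq]
    refine isNonneg_duhamel ((continuous_prev_unitFlow n).fun_const_smul _) (isNonneg_unit n)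
      (fun s hs k => ?_) ht
    simpa using mul_nonneg (hr n) (hn s hs k)
  revert t
  induction n using PNat.recOn with
  | one => exact fun {t} ht => key 1 (fun t _ k => by simp) t ht
  | succ n ih => exact fun {t} ht => key _ (fun t ht => by simpa using ih ht) t ht

/-- By induction the preceding curve has norm at most `n - 1`, so the forcing term is at most `θ n *
n`, as `norm_duhamel_le` requires with `M = n`. -/
theorem norm_unitFlow_le (hr : ∀ n, 0 ≤ r n) (hrθ : ∀ n, r n ≤ theta r a d n)
    (hθ : ∀ n, 0 < theta r a d n) (n : ℕ+) {t : ℝ} (ht : 0 ≤ t) :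
    ‖unitFlow r a d n t‖ ≤ n := by
  have key : ∀ n, (∀ t, 0 ≤ t → ‖prev (fun k => unitFlow r a d k t) n‖ ≤ n) →
      ∀ t, 0 ≤ t → ‖unitFlow r a d n t‖ ≤ n := by
    intro n hn t ht
    rw [unitFlow_eq]
    refine norm_duhamel_le (hθ n) (norm_unit n).le (fun s hs => ?_) ht
    rw [norm_smul, Real.norm_eq_abs, abs_of_nonneg (hr n)]
    exact mul_le_mul (hrθ n) (hn s hs) (norm_nonneg _) (hθ n).le
  revert t
  induction n using PNat.recOn with
  | one => exact fun {t} ht => key 1 (fun t _ => by simp) t ht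
  | succ n ih =>
    refine fun {t} ht => key _ (fun t ht => ?_) t ht
    simp only [prev_succ, PNat.add_coe, Nat.cast_add]
    exact (ih ht).trans (by simp)

end Flow

/-! ### Orbits of substochastic semigroups -/

namespace IsSubstochastic

variable {T : ℝ≥0 → MassSpace →L[ℝ] MassSpace}

theorem norm_apply_le (hT : IsSubstochastic T) (t : ℝ≥0) (f : MassSpace) : ‖T t f‖ ≤ ‖f‖ := by
  simpa using (T t).le_of_opNorm_le (hT.norm_le_one t) f

/-- One of the two truncated differences is zero, so their sum is `|t - s|`; factoring out the
earlier operator, a contraction, reduces continuity everywhere to continuity at `0`. -/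
theorem norm_orbit_sub_le (hT : IsSubstochastic T) (f : MassSpace) (s t : ℝ≥0) :
    ‖T t f - T s f‖ ≤ ‖T (t - s + (s - t)) f - f‖ := by
  wlog h : s ≤ t generalizing s t
  · rw [norm_sub_rev, add_comm]
    exact this t s (le_of_not_ge h)
  have h1 : T t f = T s (T (t - s) f) := by
    rw [← ContinuousLinearMap.comp_apply, ← hT.map_add, add_tsub_cancel_of_le h]
  rw [h1, ← map_sub, tsub_eq_zero_of_le h, add_zero]
  exact hT.norm_apply_le _ _

theorem continuous_orbit (hT : IsSubstochastic T) (f : MassSpace) : Continuous fun t => T t f := by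
  refine continuous_iff_continuousAt.mpr fun s => ?_
  refine tendsto_iff_norm_sub_tendsto_zero.mpr ?_
  refine squeeze_zero (fun _ => norm_nonneg _) (fun t => hT.norm_orbit_sub_le f s t) ?_
  have hc : Continuous fun t : ℝ≥0 => t - s + (s - t) := by fun_prop
  have h0 : Tendsto (fun t : ℝ≥0 => t - s + (s - t)) (𝓝 s) (𝓝 0) := by
    simpa using hc.tendsto s
  exact tendsto_iff_norm_sub_tendsto_zero.mp ((hT.tendsto_zero f).comp h0)

theorem hasDerivWithinAt_orbit (hT : IsSubstochastic T) {f g : MassSpace}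
    (hfg : Tendsto (fun t : ℝ≥0 => (t : ℝ)⁻¹ • (T t f - f)) (𝓝[>] 0) (𝓝 g)) {t : ℝ}
    (ht : 0 ≤ t) :
    HasDerivWithinAt (fun s : ℝ => T s.toNNReal f) (T t.toNNReal g) (Set.Ici t) t := by
  rw [← hasDerivWithinAt_Ioi_iff_Ici, hasDerivWithinAt_iff_tendsto_slope' (by simp)]
  have h1 : Tendsto (fun s : ℝ => (s - t).toNNReal) (𝓝[>] t) (𝓝[>] 0) := by
    refine tendsto_nhdsWithin_iff.mpr ⟨?_, ?_⟩
    · have hc : Continuous fun s : ℝ => (s - t).toNNReal := by fun_prop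
      have := hc.tendsto t
      simp only [sub_self, Real.toNNReal_zero] at this
      exact this.mono_left nhdsWithin_le_nhds
    · filter_upwards [self_mem_nhdsWithin] with s hs
      simpa using hs
  refine (((T t.toNNReal).continuous.tendsto g).comp (hfg.comp h1)).congr' ?_
  filter_upwards [self_mem_nhdsWithin] with s hs
  have hs' : 0 ≤ s - t := (sub_pos.mpr hs).le
  have h2 : s.toNNReal = t.toNNReal + (s - t).toNNReal := by
    rw [← Real.toNNReal_add ht hs', add_sub_cancel]
  simp only [Function.comp_apply, slope_def_module, Real.coe_toNNReal _ hs', map_smul, map_sub]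
  rw [h2, hT.map_add]
  rfl

/-- Dissipativity: before the limit the right side is the norm of `(l + 1/t) f - (1/t) T t f`, and
`T t` is a contraction. -/
theorem mul_norm_le (hT : IsSubstochastic T) {f g : MassSpace}
    (hfg : Tendsto (fun t : ℝ≥0 => (t : ℝ)⁻¹ • (T t f - f)) (𝓝[>] 0) (𝓝 g)) (l : ℝ) :
    l * ‖f‖ ≤ ‖l • f - g‖ := by
  refine ge_of_tendsto ((tendsto_const_nhds.sub hfg).norm) ?_
  filter_upwards [self_mem_nhdsWithin] with t ht
  have ht' : (0 : ℝ) < t := ht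
  have h1 : l • f - (t : ℝ)⁻¹ • (T t f - f) = (l + (t : ℝ)⁻¹) • f - (t : ℝ)⁻¹ • T t f := by
    module
  have h2 : (l + (t : ℝ)⁻¹) * ‖f‖ ≤ ‖(l + (t : ℝ)⁻¹) • f‖ := by
    rw [norm_smul]
    exact mul_le_mul_of_nonneg_right (le_abs_self _) (norm_nonneg _)
  have h3 : ‖(t : ℝ)⁻¹ • T t f‖ ≤ (t : ℝ)⁻¹ * ‖f‖ := by
    rw [norm_smul, Real.norm_of_nonneg (by positivity)]
    exact mul_le_mul_of_nonneg_left (hT.norm_apply_le t f) (by positivity)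
  rw [h1]
  linarith [norm_sub_norm_le ((l + (t : ℝ)⁻¹) • f) ((t : ℝ)⁻¹ • T t f)]

theorem isDecayFlow (hT : IsSubstochastic T) {r a d : ℕ+ → ℝ}
    (h : ∀ n, Tendsto (fun t : ℝ≥0 => (t : ℝ)⁻¹ • (T t (unit n) - unit n)) (𝓝[>] 0)
      (𝓝 (unitImage r a d n))) :
    IsDecayFlow r a d fun n t => T t.toNNReal (unit n) where
  continuous n := (hT.continuous_orbit _).comp continuous_real_toNNReal
  deriv n t ht := by
    refine (hT.hasDerivWithinAt_orbit (h n) ht).congr_deriv ?_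
    rw [unitImage, map_add, map_neg, map_smul, map_smul, map_prev]

end IsSubstochastic

/-! ### The semigroup of the decay equation -/

/-- Positive decay rates `r n ≤ θ n`. -/
structure DecayRates (r a d : ℕ+ → ℝ) : Prop where
  pos : ∀ n, 0 < r n
  le_theta : ∀ n, r n ≤ theta r a d n

namespace DecayRates

variable {r a d : ℕ+ → ℝ} (h : DecayRates r a d)

theorem theta_pos (h : DecayRates r a d) (n : ℕ+) : 0 < theta r a d n := (h.pos n).trans_le (h.le_theta n)

theorem norm_unitFlow_le (h : DecayRates r a d) (t : ℝ≥0) (n : ℕ+) : ‖unitFlow r a d n t‖ ≤ 1 * n := by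
  rw [one_mul]
  exact _root_.norm_unitFlow_le (fun n => (h.pos n).le) h.le_theta h.theta_pos n t.2

/-- The semigroup sending the `n`-th unit sequence along its trajectory. -/
noncomputable def semigroup (t : ℝ≥0) : MassSpace →L[ℝ] MassSpace :=
  ofUnits (fun n => unitFlow r a d n t) 1 (h.norm_unitFlow_le t)

theorem semigroup_unit (t : ℝ≥0) (n : ℕ+) : h.semigroup t (unit n) = unitFlow r a d n t :=
  ofUnits_unit _ n

theorem continuous_semigroup (f : MassSpace) : Continuous fun t => h.semigroup t f := by
  have hs : Summable fun n : ℕ+ => (n : ℝ) * |seq f n| := seq_mem f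
  refine continuous_tsum (f := fun n (t : ℝ≥0) => seq f n • unitFlow r a d n t) (fun n => ?_) hs
    fun n t => ?_
  · exact (((isDecayFlow_unitFlow r a d).continuous n).comp NNReal.continuous_coe).fun_const_smul _
  · rw [norm_smul, Real.norm_eq_abs, mul_comm]
    exact mul_le_mul_of_nonneg_right (by simpa using h.norm_unitFlow_le t n) (abs_nonneg _)

theorem semigroup_zero : h.semigroup 0 = ContinuousLinearMap.id ℝ MassSpace :=
  clm_ext_unit fun n => by
    rw [semigroup_unit, NNReal.coe_zero, unitFlow_zero, ContinuousLinearMap.id_apply]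

theorem semigroup_add (s t : ℝ≥0) : h.semigroup (s + t) = (h.semigroup s).comp (h.semigroup t) := by
  refine clm_ext_unit fun n => ?_
  -- Both `t ↦ u n (t + s)` and `t ↦ S s (u n t)` are decay flows with the same initial values.
  have := ((isDecayFlow_unitFlow r a d).shift s.2).unique
    ((isDecayFlow_unitFlow r a d).map (h.semigroup s)) (fun n => ?_) n t t.2
  · rw [ContinuousLinearMap.comp_apply, semigroup_unit, semigroup_unit, ← this, NNReal.coe_add,
      add_comm]
    rfl
  · rw [unitFlow_zero, semigroup_unit, zero_add]
    rfl

theorem isSubstochastic_semigroup : IsSubstochastic h.semigroup where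
  map_zero := h.semigroup_zero
  map_add := h.semigroup_add
  tendsto_zero f := by
    have := (h.continuous_semigroup f).tendsto 0
    rwa [semigroup_zero] at this
  nonneg t f hf := isNonneg_ofUnits _
    (fun n => isNonneg_unitFlow (fun n => (h.pos n).le) n t.2) hf
  norm_le_one t := norm_ofUnits_le zero_le_one _

theorem eq_semigroup {T : ℝ≥0 → MassSpace →L[ℝ] MassSpace} (hT : IsSubstochastic T)
    (hgen : ∀ n, Tendsto (fun t : ℝ≥0 => (t : ℝ)⁻¹ • (T t (unit n) - unit n)) (𝓝[>] 0)
      (𝓝 (unitImage r a d n))) : T = h.semigroup := by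
  funext t
  refine clm_ext_unit fun n => ?_
  have := (hT.isDecayFlow hgen).unique (isDecayFlow_unitFlow r a d) (fun n => ?_) n t t.2
  · rwa [Real.toNNReal_coe, ← h.semigroup_unit] at this
  · rw [Real.toNNReal_zero, hT.map_zero, unitFlow_zero, ContinuousLinearMap.id_apply]

end DecayRates

/-! ### The operator on finitely supported sequences and its closure -/

/-- The graph of the decay operator on the finitely supported sequences. -/
noncomputable def coreGraph (r a d : ℕ+ → ℝ) : Submodule ℝ (MassSpace × MassSpace) :=
  Submodule.span ℝ (Set.range fun n => (unit n, unitImage r a d n))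

namespace DecayRates

variable {r a d : ℕ+ → ℝ} (h : DecayRates r a d)

theorem hasDerivWithinAt_semigroup {p : MassSpace × MassSpace} (hp : p ∈ coreGraph r a d) {t : ℝ}
    (ht : 0 ≤ t) : HasDerivWithinAt (fun s : ℝ => h.semigroup s.toNNReal p.1)
      (h.semigroup t.toNNReal p.2) (Set.Ici t) t := by
  induction hp using Submodule.span_induction with
  | mem p hp =>
    obtain ⟨n, rfl⟩ := hp
    refine (((isDecayFlow_unitFlow r a d).deriv n t ht).congr (f₁ := fun s : ℝ =>
      h.semigroup s.toNNReal (unit n)) (fun s hs => ?_) ?_).congr_deriv ?_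
    · rw [h.semigroup_unit, Real.coe_toNNReal s (ht.trans hs)]
    · rw [h.semigroup_unit, Real.coe_toNNReal t ht]
    · change _ = h.semigroup t.toNNReal (unitImage r a d n)
      rw [unitImage, map_add, map_neg, map_smul, map_smul, map_prev]
      simp only [h.semigroup_unit, Real.coe_toNNReal t ht]
  | zero => simpa using hasDerivWithinAt_const t (Set.Ici t) (0 : MassSpace)
  | add p q _ _ hp hq =>
    simp only [Prod.fst_add, Prod.snd_add, map_add]
    exact hp.add hq
  | smul c p _ hp =>
    simp only [Prod.smul_fst, Prod.smul_snd, map_smul]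
    exact hp.const_smul c

/-- Mean value inequality for `s ↦ S s p.1 - s p.2`, with right derivative `S s p.2 - p.2`. Unlike a
bare limit, this estimate survives passage to the closed graph. -/
theorem norm_semigroup_sub_le {p : MassSpace × MassSpace} (hp : p ∈ coreGraph r a d) {t : ℝ≥0}
    {C : ℝ} (hC : ∀ s ≤ t, ‖h.semigroup s p.2 - p.2‖ ≤ C) :
    ‖h.semigroup t p.1 - p.1 - (t : ℝ) • p.2‖ ≤ C * t := by
  have hd : ∀ s ∈ Set.Ico (0 : ℝ) t, HasDerivWithinAt
      (fun s : ℝ => h.semigroup s.toNNReal p.1 - s • p.2)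
      (h.semigroup s.toNNReal p.2 - p.2) (Set.Ici s) s := fun s hs =>
    ((h.hasDerivWithinAt_semigroup hp hs.1).sub
      ((hasDerivWithinAt_id s _).smul_const p.2)).congr_deriv (by simp)
  have hc : Continuous fun s : ℝ => h.semigroup s.toNNReal p.1 - s • p.2 :=
    ((h.continuous_semigroup p.1).comp continuous_real_toNNReal).sub
      (continuous_id.smul continuous_const)
  have := norm_image_sub_le_of_norm_deriv_right_le_segment hc.continuousOn hd
    (fun s hs => hC _ (Real.toNNReal_le_iff_le_coe.mpr hs.2.le)) t ⟨t.2, le_rfl⟩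
  rw [Real.toNNReal_coe, Real.toNNReal_zero, h.semigroup_zero, zero_smul, sub_zero, sub_zero,
    ContinuousLinearMap.id_apply, sub_right_comm] at this
  exact this

theorem norm_semigroup_sub_le_of_mem_closure {p : MassSpace × MassSpace}
    (hp : p ∈ (coreGraph r a d).topologicalClosure) {t : ℝ≥0}
    {C : ℝ} (hC : ∀ s ≤ t, ‖h.semigroup s p.2 - p.2‖ ≤ C) :
    ‖h.semigroup t p.1 - p.1 - (t : ℝ) • p.2‖ ≤ C * t := by
  obtain ⟨q, hq, hqp⟩ := mem_closure_iff_seq_limit.mp hp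
  have h1 := (continuous_fst.tendsto p).comp hqp
  have h2 := (continuous_snd.tendsto p).comp hqp
  -- The factor `2` comes from `‖S s x - x‖ ≤ 2 ‖x‖` with `x = (q k).2 - p.2`.
  have hR : Tendsto (fun k => (C + 2 * ‖(q k).2 - p.2‖) * t) atTop (𝓝 (C * t)) := by
    have := (tendsto_iff_norm_sub_tendsto_zero.mp h2).const_mul 2
    simpa using (this.const_add C).mul_const (t : ℝ)
  have hL : Tendsto (fun k => ‖h.semigroup t (q k).1 - (q k).1 - (t : ℝ) • (q k).2‖) atTop
      (𝓝 ‖h.semigroup t p.1 - p.1 - (t : ℝ) • p.2‖) :=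
    (((((h.semigroup t).continuous.tendsto _).comp h1).sub h1).sub (h2.const_smul _)).norm
  refine le_of_tendsto_of_tendsto' hL hR fun k => h.norm_semigroup_sub_le (hq k) fun s hs => ?_
  have h3 : h.semigroup s (q k).2 - (q k).2 =
      (h.semigroup s p.2 - p.2) + (h.semigroup s ((q k).2 - p.2) - ((q k).2 - p.2)) := by
    rw [map_sub]; abel
  rw [h3]
  linarith [norm_add_le (h.semigroup s p.2 - p.2)
    (h.semigroup s ((q k).2 - p.2) - ((q k).2 - p.2)), hC s hs,
    norm_sub_le (h.semigroup s ((q k).2 - p.2)) ((q k).2 - p.2),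
    h.isSubstochastic_semigroup.norm_apply_le s ((q k).2 - p.2)]

theorem tendsto_of_mem_closure {p : MassSpace × MassSpace}
    (hp : p ∈ (coreGraph r a d).topologicalClosure) :
    Tendsto (fun t : ℝ≥0 => (t : ℝ)⁻¹ • (h.semigroup t p.1 - p.1)) (𝓝[>] 0) (𝓝 p.2) := by
  refine Metric.tendsto_nhds.mpr fun ε hε => ?_
  have h0 := Metric.tendsto_nhds.mp (h.isSubstochastic_semigroup.tendsto_zero p.2) (ε / 2)
    (by positivity)
  obtain ⟨δ, hδ, hball⟩ := Metric.eventually_nhds_iff.mp h0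
  have hev : ∀ᶠ t : ℝ≥0 in 𝓝[>] 0, dist t 0 < δ :=
    nhdsWithin_le_nhds (Metric.ball_mem_nhds 0 hδ)
  filter_upwards [hev, self_mem_nhdsWithin] with t ht htpos
  have htpos' : (0 : ℝ) < t := htpos
  have hC : ∀ s ≤ t, ‖h.semigroup s p.2 - p.2‖ ≤ ε / 2 := fun s hs => by
    rw [← dist_eq_norm]
    refine (hball (lt_of_le_of_lt ?_ ht)).le
    rw [NNReal.dist_eq, NNReal.dist_eq]
    simpa using hs
  have h1 : (t : ℝ)⁻¹ • (h.semigroup t p.1 - p.1) - p.2 =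
      (t : ℝ)⁻¹ • (h.semigroup t p.1 - p.1 - (t : ℝ) • p.2) := by
    rw [smul_sub _ _ ((t : ℝ) • p.2), inv_smul_smul₀ htpos'.ne']
  rw [dist_eq_norm, h1, norm_smul, Real.norm_of_nonneg (by positivity), inv_mul_lt_iff₀ htpos']
  nlinarith [h.norm_semigroup_sub_le_of_mem_closure hp hC]

/-! ### The resolvent equation -/

theorem mul_norm_fst_le (h : DecayRates r a d) {p : MassSpace × MassSpace}
    (hp : p ∈ (coreGraph r a d).topologicalClosure) (l : ℝ) : l * ‖p.1‖ ≤ ‖l • p.1 - p.2‖ :=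
  h.isSubstochastic_semigroup.mul_norm_le (h.tendsto_of_mem_closure hp) l

/-- Since `(l - A) e n = (l + θ n) e n - r n e (n - 1)` and `l + θ n > 0`, the range contains `e n`
as soon as it contains `e (n - 1)`. -/
theorem exists_resolvent_unit (h : DecayRates r a d) {l : ℝ} (hl : 0 < l) (n : ℕ+) :
    unit n ∈ (coreGraph r a d).map
      (l • LinearMap.fst ℝ MassSpace MassSpace - LinearMap.snd ℝ MassSpace MassSpace) := by
  set W := (coreGraph r a d).map
    (l • LinearMap.fst ℝ MassSpace MassSpace - LinearMap.snd ℝ MassSpace MassSpace) with hW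
  have key : ∀ n, prev unit n ∈ W → unit n ∈ W := by
    intro n hn
    have h1 : l • unit n - unitImage r a d n ∈ W :=
      Submodule.mem_map.mpr ⟨(unit n, unitImage r a d n),
        Submodule.subset_span (Set.mem_range_self n), rfl⟩
    have hne : l + theta r a d n ≠ 0 := (add_pos hl (h.theta_pos n)).ne'
    have h2 := W.smul_mem (l + theta r a d n)⁻¹ (W.add_mem h1 (W.smul_mem (r n) hn))
    have h3 : l • unit n - unitImage r a d n + r n • prev unit n =
        (l + theta r a d n) • unit n := by
      rw [unitImage, add_smul]; abel
    rwa [h3, inv_smul_smul₀ hne] at h2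
  induction n using PNat.recOn with
  | one => exact key 1 (by simp)
  | succ n ih => exact key _ (by simpa using ih)

theorem exists_resolvent (h : DecayRates r a d) {l : ℝ} (hl : 0 < l) (f : MassSpace) :
    ∃ p ∈ (coreGraph r a d).topologicalClosure, l • p.1 - p.2 = f := by
  set V := (coreGraph r a d).topologicalClosure
  have : CompleteSpace V := (Submodule.isClosed_topologicalClosure _).completeSpace_coe
  let Φ : V →L[ℝ] MassSpace :=
    (l • ContinuousLinearMap.fst ℝ MassSpace MassSpace -
      ContinuousLinearMap.snd ℝ MassSpace MassSpace).comp V.subtypeL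
  have hΦ : ∀ p : V, Φ p = l • p.1.1 - p.1.2 := fun p => rfl
  -- The two components of `p` are bounded by `l⁻¹ ‖Φ p‖` and `2 ‖Φ p‖`; the sum of the constants
  -- dominates the maximum.
  have hanti : AntilipschitzWith (l⁻¹ + 2).toNNReal Φ := by
    refine ContinuousLinearMap.antilipschitz_of_bound _ fun p => ?_
    have h1 := h.mul_norm_fst_le p.2 l
    rw [← hΦ] at h1
    have h2 : ‖p.1.1‖ ≤ l⁻¹ * ‖Φ p‖ := by
      rw [← div_eq_inv_mul, le_div_iff₀ hl]; linarith
    have h3 : ‖p.1.2‖ ≤ 2 * ‖Φ p‖ := by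
      have h4 : p.1.2 = l • p.1.1 - Φ p := by rw [hΦ]; abel
      have h5 := norm_sub_le (l • p.1.1) (Φ p)
      rw [← h4, norm_smul, Real.norm_of_nonneg hl.le] at h5
      linarith
    rw [Real.coe_toNNReal _ (by positivity), add_mul]
    refine max_le (h2.trans ?_) (h3.trans ?_)
    · have := norm_nonneg (Φ p); linarith
    · have : 0 ≤ l⁻¹ * ‖Φ p‖ := by positivity
      linarith
  have hclosed := hanti.isClosed_range Φ.uniformContinuous
  have hdense : Dense (Set.range Φ) := by
    refine (span_unit_dense (W := LinearMap.range Φ.toLinearMap) fun n => ?_)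
    obtain ⟨p, hp, hpn⟩ := h.exists_resolvent_unit hl n
    exact ⟨⟨p, Submodule.le_topologicalClosure _ hp⟩, hpn⟩
  obtain ⟨p, hp⟩ : f ∈ Set.range Φ := by
    rw [← hclosed.closure_eq, hdense.closure_eq]; trivial
  exact ⟨p, p.2, hp⟩

/-- For the converse, solve the resolvent equation at `l = 1` inside the closed graph with the same
right-hand side; dissipativity of the generator makes the two solutions equal. -/
theorem mem_closure_iff_tendsto (f g : MassSpace) :
    (f, g) ∈ (coreGraph r a d).topologicalClosure ↔
      Tendsto (fun t : ℝ≥0 => (t : ℝ)⁻¹ • (h.semigroup t f - f)) (𝓝[>] 0) (𝓝 g) := by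
  refine ⟨fun hp => h.tendsto_of_mem_closure (p := (f, g)) hp, fun hfg => ?_⟩
  obtain ⟨p, hp, hpf⟩ := h.exists_resolvent one_pos ((1 : ℝ) • f - g)
  have hd' : Tendsto (fun t : ℝ≥0 => (t : ℝ)⁻¹ • (h.semigroup t (f - p.1) - (f - p.1)))
      (𝓝[>] 0) (𝓝 (g - p.2)) := by
    have he : ∀ t : ℝ≥0, (t : ℝ)⁻¹ • (h.semigroup t (f - p.1) - (f - p.1)) =
        (t : ℝ)⁻¹ • (h.semigroup t f - f) - (t : ℝ)⁻¹ • (h.semigroup t p.1 - p.1) := fun t => by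
      rw [← smul_sub, map_sub, sub_sub_sub_comm]
    simp only [he]
    exact hfg.sub (h.tendsto_of_mem_closure hp)
  have h1 := h.isSubstochastic_semigroup.mul_norm_le hd' 1
  have h2 : (1 : ℝ) • (f - p.1) - (g - p.2) = 0 := by
    rw [smul_sub, sub_sub_sub_comm, hpf, sub_self]
  rw [h2, norm_zero, one_mul] at h1
  have h3 : f = p.1 := sub_eq_zero.mp (norm_le_zero_iff.mp h1)
  have h4 : g = p.2 := by
    rw [h3, sub_self, smul_zero, zero_sub, neg_eq_zero] at h2
    exact sub_eq_zero.mp h2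
  rwa [h3, h4]

end DecayRates

/-! ### Identification of the closure -/

section Operators

variable {r a d : ℕ+ → ℝ}

theorem mem_graph_opKmax {f g : MassSpace} : (f, g) ∈ (opKmax r a d).graph ↔
    (formalDiag r a d + formalShift r) (seq f) = seq g := by
  rw [LinearPMap.mem_graph_iff]
  constructor
  · rintro ⟨y, rfl, rfl⟩
    rfl
  · intro hg
    have hf : (formalDiag r a d + formalShift r) (seq f) ∈ finiteMass := hg ▸ seq_mem g
    exact ⟨⟨f, hf⟩, rfl, seq_injective hg⟩

/-- The graph is cut out by one equation per coordinate, each involving only continuous functionals.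
-/
theorem isClosed_opKmax : (opKmax r a d).IsClosed := by
  have h : ((opKmax r a d).graph : Set (MassSpace × MassSpace)) =
      ⋂ n, {p | -(theta r a d n * coord n p.1) + r (n + 1) * coord (n + 1) p.1 = coord n p.2} := by
    ext p
    rw [SetLike.mem_coe, mem_graph_opKmax, funext_iff, Set.mem_iInter]
    rfl
  rw [LinearPMap.IsClosed, h]
  exact isClosed_iInter fun n => isClosed_eq (by fun_prop) (by fun_prop)

theorem mem_graph_opDecay {f g : MassSpace} : (f, g) ∈ (opDecay r a d).graph ↔
    (f ∈ (opDiag r a d).domain ∧ f ∈ (opShift r).domain) ∧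
      (formalDiag r a d + formalShift r) (seq f) = seq g := by
  rw [LinearPMap.mem_graph_iff]
  constructor
  · rintro ⟨y, rfl, rfl⟩
    exact ⟨y.2, rfl⟩
  · rintro ⟨hf, hg⟩
    exact ⟨⟨f, hf⟩, rfl, seq_injective hg⟩

theorem opDecay_le_opKmax : opDecay r a d ≤ opKmax r a d :=
  LinearPMap.le_of_le_graph fun _ hp => mem_graph_opKmax.mpr (mem_graph_opDecay.mp hp).2

theorem isClosable_opDecay : (opDecay r a d).IsClosable :=
  isClosed_opKmax.isClosable.leIsClosable opDecay_le_opKmax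

theorem opK_graph : (opK r a d).graph = (opDecay r a d).graph.topologicalClosure :=
  isClosable_opDecay.graph_closure_eq_closure_graph.symm

theorem opK_le_opKmax : opK r a d ≤ opKmax r a d :=
  LinearPMap.le_of_le_graph <| by
    rw [opK_graph]
    exact Submodule.topologicalClosure_minimal _
      (LinearPMap.le_graph_of_le opDecay_le_opKmax) isClosed_opKmax

theorem unit_mem_maximalDomain_formalMul (w : ℕ+ → ℝ) (n : ℕ+) :
    unit n ∈ maximalDomain (formalMul w) := by
  have h : formalMul w (seq (unit n)) = seq (w n • unit n) := by
    funext k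
    by_cases hk : k = n
    · simp [formalMul, hk]
    · simp [formalMul, seq_unit, hk]
  change formalMul w (seq (unit n)) ∈ finiteMass
  rw [h]
  exact seq_mem _

theorem unit_mem_graph_opDecay (n : ℕ+) :
    (unit n, unitImage r a d n) ∈ (opDecay r a d).graph :=
  mem_graph_opDecay.mpr ⟨⟨unit_mem_maximalDomain_formalMul _ n,
    unit_mem_maximalDomain_formalMul _ n⟩, (seq_unitImage r a d n).symm⟩

theorem coreGraph_le_graph_opDecay : coreGraph r a d ≤ (opDecay r a d).graph :=
  Submodule.span_le.mpr <| Set.range_subset_iff.mpr unit_mem_graph_opDecay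

/-- Because `θ f` and `r f` lie in `X`, the diagonal and shifted series converge separately; hence
truncations of `f` converge in the graph norm. -/
theorem hasSum_unitImage {f g : MassSpace} (hfg : (f, g) ∈ (opDecay r a d).graph) :
    HasSum (fun n => seq f n • unitImage r a d n) g := by
  obtain ⟨⟨h0, h1⟩, hg⟩ := mem_graph_opDecay.mp hfg
  have h0' : formalMul (theta r a d) (seq f) ∈ finiteMass := h0
  have h1' : formalShift r (seq f) ∈ finiteMass := formalShift_mem r _ h1
  have hs0 := (hasSum_unit (mk _ h0')).neg
  have hs1 : HasSum (fun n => seq f n • r n • prev unit n) (mk _ h1') := by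
    have hinj : Function.Injective fun n : ℕ+ => n + 1 := fun m n h => add_right_cancel h
    -- Reindexing by `n ↦ n + 1` loses only the term at `1`, which is zero since `prev unit 1 = 0`.
    refine (hinj.hasSum_iff fun n hn => ?_).mp ?_
    · induction n using PNat.recOn with
      | one => simp
      | succ n _ => exact absurd ⟨n, rfl⟩ hn
    · convert hasSum_unit (mk _ h1') using 2 with n
      rw [Function.comp_apply, prev_succ, smul_smul, mul_comm]
      rfl
  have hg' : g = -mk _ h0' + mk _ h1' := by
    refine seq_injective (hg.symm.trans ?_)
    rw [map_add, map_neg]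
    rfl
  rw [hg']
  refine (funext fun n => ?_ : (fun n => seq f n • unitImage r a d n) = _) ▸ hs0.add hs1
  have h2 : seq (mk _ h0') n = seq f n * theta r a d n := mul_comm _ _
  rw [h2, unitImage, smul_add, smul_neg, smul_smul]

theorem graph_opDecay_le : (opDecay r a d).graph ≤ (coreGraph r a d).topologicalClosure := by
  rintro ⟨f, g⟩ hfg
  refine mem_closure_of_tendsto ((hasSum_unit f).prodMk (hasSum_unitImage hfg))
    (.of_forall fun s => (coreGraph r a d).sum_mem fun n _ => ?_)
  exact (coreGraph r a d).smul_mem _ (Submodule.subset_span (Set.mem_range_self n))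

theorem opK_graph_eq : (opK r a d).graph = (coreGraph r a d).topologicalClosure := by
  rw [opK_graph]
  exact le_antisymm
    (Submodule.topologicalClosure_minimal _ graph_opDecay_le
      (Submodule.isClosed_topologicalClosure _))
    (Submodule.topologicalClosure_mono coreGraph_le_graph_opDecay)

theorem DecayRates.generatesSmallest (h : DecayRates r a d) :
    GeneratesSmallestSubstochastic (opDecay r a d) (opK r a d) := by
  refine ⟨(opDecay r a d).le_closure, h.semigroup, h.isSubstochastic_semigroup,
    fun f g => ?_, fun T G hT hG hle t f _ => ?_⟩
  · rw [opK_graph_eq]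
    exact h.mem_closure_iff_tendsto f g
  · rw [h.eq_semigroup hT fun n => (hG _ _).mp
      (LinearPMap.le_graph_of_le hle (unit_mem_graph_opDecay n)), sub_self]
    exact fun n => by simp

/-- Dissipativity of `K` excludes eigenvectors for `l > 0`. Conversely, for `f` in `D(K_max)` the
solution `p.1` in `D(K)` of the same resolvent equation differs from `f` by an element of the kernel
of `l - K_max`. -/
theorem DecayRates.domain_eq_iff (h : DecayRates r a d) {l : ℝ} (hl : 0 < l) :
    (opK r a d).domain = (opKmax r a d).domain ↔
      ¬ ∃ f : MassSpace, f ≠ 0 ∧ formalDiag r a d (seq f) + formalShift r (seq f) = l • seq f := by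
  constructor
  · rintro heq ⟨f, hf0, hf⟩
    have hmax : (f, l • f) ∈ (opKmax r a d).graph := mem_graph_opKmax.mpr (by simpa using hf)
    have hK : (f, l • f) ∈ (opK r a d).graph := by
      rwa [LinearPMap.eq_of_le_of_domain_eq opK_le_opKmax heq]
    rw [opK_graph_eq] at hK
    have h1 := h.mul_norm_fst_le hK l
    rw [sub_self, norm_zero] at h1
    exact hf0 (norm_le_zero_iff.mp (nonpos_of_mul_nonpos_right h1 hl))
  · intro hne
    refine le_antisymm opK_le_opKmax.1 fun f hf => ?_
    obtain ⟨p, hp, hpf⟩ := h.exists_resolvent hl (l • f - opKmax r a d ⟨f, hf⟩)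
    rw [← opK_graph_eq] at hp
    have hp' := LinearPMap.le_graph_of_le opK_le_opKmax hp
    have hf' : (f, opKmax r a d ⟨f, hf⟩) ∈ (opKmax r a d).graph :=
      (opKmax r a d).mem_graph ⟨f, hf⟩
    have hsub := (opKmax r a d).graph.sub_mem hf' hp'
    have h2 : opKmax r a d ⟨f, hf⟩ - p.2 = l • (f - p.1) := by
      rw [← sub_eq_zero, smul_sub, ← sub_eq_zero.mpr hpf]; abel
    have h3 : f = p.1 := by
      by_contra hfp
      refine hne ⟨f - p.1, sub_ne_zero.mpr hfp, ?_⟩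
      have := mem_graph_opKmax.mp hsub
      rw [h2] at this
      simpa using this
    rw [h3]
    exact LinearPMap.mem_domain_of_mem_graph hp

/-! ### Dimension of the solution spaces -/

theorem formalSolutions_apply_succ {l : ℝ} {f : ℕ+ → ℝ} (hf : f ∈ formalSolutions r a d l)
    (n : ℕ+) : r (n + 1) * f (n + 1) = (l + theta r a d n) * f n := by
  have h : -(theta r a d n * f n) + r (n + 1) * f (n + 1) = l * f n := congrFun hf n
  linarith

/-- Evaluation at `1` is injective on solutions, as the recursion can be solved for `f (n + 1)` when
`r (n + 1) ≠ 0`. -/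
theorem rank_formalSolutions_le_one (hr : ∀ n, r n ≠ 0) (l : ℝ) :
    Module.rank ℝ (formalSolutions r a d l) ≤ 1 := by
  rw [← Module.rank_self ℝ]
  refine LinearMap.rank_le_of_injective
    ((LinearMap.proj 1 : (ℕ+ → ℝ) →ₗ[ℝ] ℝ) ∘ₗ (formalSolutions r a d l).subtype) ?_
  refine (injective_iff_map_eq_zero _).mpr fun f hf => Subtype.ext (funext fun n => ?_)
  induction n using PNat.recOn with
  | one => exact hf
  | succ n ih =>
    have h := formalSolutions_apply_succ f.2 n
    rw [ih] at h
    simpa [hr] using h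

theorem rank_solutionsInX_le_one (hr : ∀ n, r n ≠ 0) (l : ℝ) :
    Module.rank ℝ (solutionsInX r a d l) ≤ 1 := by
  refine le_trans ?_ (rank_formalSolutions_le_one (a := a) (d := d) hr l)
  refine LinearMap.rank_le_of_injective
    ((seq ∘ₗ (solutionsInX r a d l).subtype).codRestrict (formalSolutions r a d l) fun f => f.2) fun f g hfg => ?_
  have h : seq f.1 = seq g.1 := congrArg (formalSolutions r a d l).subtype hfg
  exact Subtype.ext (seq_injective h)

end Operators

theorem mainTheorem6 (r a d : ℕ+ → ℝ) (hr : ∀ n, 0 < r n) (ha_one : a 1 = 0)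
    (ha : ∀ n, 2 ≤ n → 0 < a n) (hd : ∀ n, 0 ≤ d n) :
    (opDecay r a d).IsClosable ∧
    GeneratesSmallestSubstochastic (opDecay r a d) (opK r a d) ∧
    ∀ l : ℝ, 0 < l →
      ((opK r a d).domain = (opKmax r a d).domain ↔
        ¬ ∃ f : MassSpace, f ≠ 0 ∧
          formalDiag r a d (MassSpace.seq f) + formalShift r (MassSpace.seq f) =
            l • MassSpace.seq f) ∧
      Module.rank ℝ (formalSolutions r a d l) ≤ 1 ∧
      Module.rank ℝ (solutionsInX r a d l) ≤ 1 := by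
  have ha' : ∀ n, 0 ≤ a n := fun n => by
    rcases eq_or_ne n 1 with rfl | hn
    · exact ha_one.ge
    · exact (ha n (PNat.add_one_le_iff.mpr (lt_of_le_of_ne one_le hn.symm))).le
  have h : DecayRates r a d := ⟨hr, fun n => by rw [theta]; linarith [ha' n, hd n]⟩
  exact ⟨isClosable_opDecay, h.generatesSmallest, fun l hl => ⟨h.domain_eq_iff hl,
    rank_formalSolutions_le_one (fun n => (hr n).ne') l,
    rank_solutionsInX_le_one (fun n => (hr n).ne') l⟩⟩
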